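/- Let $\mathcal G$ be the set of continuous nondecreasing functions $g:[0,1]\to\mathbb R$ with $g(0)=0$ and $g(1)=1$, and for $a,b,c>0$ let $$f_{a,b,c}(t)=\bigl(1-(1-t^a)^b\bigr)^c,\qquad t\in[0,1].$$ Then $$\sup_{g\in\mathcal G}\ \inf_{a,b,c>0}\ \int_0^1\bigl[f_{a,b,c}(t)-g(t)\bigr]^2\,dt\ \le\ \frac1{16}.$$ Moreover, for every $g\in\mathcal G$ there exist $a,b,c>0$ with $\int_0^1[f_{a,b,c}(t)-g(t)]^2\,dt\le\frac1{16}$. -/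

import Mathlib

/-- The generalized Kumaraswamy transformation `f_{a,b,c}(t) = (1 - (1 - t^a)^b)^c`
(real powers; used for `a, b, c > 0` and `t ∈ [0,1]`, where every base lies in `[0,1]`). -/
noncomputable def kumaraswamy (a b c t : ℝ) : ℝ :=
  (1 - (1 - t ^ a) ^ b) ^ c

/-- The class `𝒢` of continuous nondecreasing functions on `[0,1]` with `g 0 = 0` and `g 1 = 1`.
Only the values of `g` on `[0,1]` are constrained. -/
def monotoneClass : Set (ℝ → ℝ) :=
  {g | ContinuousOn g (Set.Icc 0 1) ∧ MonotoneOn g (Set.Icc 0 1) ∧ g 0 = 0 ∧ g 1 = 1}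

/-- The squared `L²([0,1])` error between the transformation and `g`. -/
noncomputable def kumaraswamyError (g : ℝ → ℝ) (a b c : ℝ) : ℝ :=
  ∫ t in (0 : ℝ)..1, (kumaraswamy a b c t - g t) ^ 2

open Set Filter Topology MeasureTheory

/-! As `a → ∞` and `c → 0`, the family behaves like `min(1, b t^a)^c`. Its limits include every jump
from 0 to 1 at a point `s > 0` and every truncated power `min(1, A t^k)` with `A > 0`, `k ≥ 0`. By
dominated convergence it suffices that some such limit has squared error strictly below 1/16.

Read `g` as the distribution function of a random variable `Y` on `[0,1]` with median `s`. Let `u`,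
`v` be the means of its lower and upper halves and `h` the sum of their half mean differences. The
jump at `s` has error `(v - u - h)/4`, which suffices when `v - u - h < 1/4`. Otherwise a constant
works if `h > 2u`, a multiple of `√t` if `h ≤ 2u` and `u ≤ 6/25`, and a multiple of `t` if `u ≥
6/25`.

The error of `A t^k` involves `∫ t^k g`, that is, the moment `E Y^(k+1)`. For `k = 1` it is
controlled because a variable in an interval of length `ℓ` has variance at most `ℓ` times half its
mean difference (`variance_le_covariance_id`). For `k = 1/2`, AM-GM reduces `E Y^(3/2)` to the first
two moments (`le_integral_sqrt_mul`). What remains are polynomial inequalities in `u`, `v`, `h`,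
checked on finitely many rectangles. -/

/-! ### Limits of the family: jumps and truncated powers. -/

theorem kumaraswamy_mem_Icc {a b c t : ℝ} (ha : 0 < a) (hb : 0 < b) (hc : 0 < c)
    (ht : t ∈ Icc (0 : ℝ) 1) : kumaraswamy a b c t ∈ Icc (0 : ℝ) 1 := by
  have h1 : 0 ≤ 1 - t ^ a := sub_nonneg.2 (Real.rpow_le_one ht.1 ht.2 ha.le)
  have h2 : 1 - t ^ a ≤ 1 := by linarith [Real.rpow_nonneg ht.1 a]
  have h3 : 0 ≤ 1 - (1 - t ^ a) ^ b := sub_nonneg.2 (Real.rpow_le_one h1 h2 hb.le)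
  have h4 : 1 - (1 - t ^ a) ^ b ≤ 1 := by linarith [Real.rpow_nonneg h1 b]
  exact ⟨Real.rpow_nonneg h3 c, Real.rpow_le_one h3 h4 hc.le⟩

/-- Together with the next bound, this pins `1 - (1 - x)^b` to `min 1 (b * x)` up to a factor 2,
uniformly in `b`. Such factors disappear in the limit, since `K ^ c → 1` as `c → 0`. -/
theorem half_min_le_one_sub_rpow {b x : ℝ} (hb : 0 < b) (hx : 0 ≤ x) (hx1 : x ≤ 1) :
    1 / 2 * min 1 (b * x) ≤ 1 - (1 - x) ^ b := by
  have h1 : (1 - x) ^ b ≤ Real.exp (-(b * x)) := by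
    calc (1 - x) ^ b ≤ Real.exp (-x) ^ b :=
          Real.rpow_le_rpow (by linarith) (Real.one_sub_le_exp_neg x) hb.le
      _ = Real.exp (-(b * x)) := by rw [← Real.exp_mul]; congr 1; ring
  have hz : 0 ≤ b * x := by positivity
  have h2 : Real.exp (-(b * x)) ≤ 1 / (1 + b * x) := by
    rw [Real.exp_neg, ← one_div]
    exact one_div_le_one_div_of_le (by linarith) (by linarith [Real.add_one_le_exp (b * x)])
  have h3 : 1 / 2 * min 1 (b * x) ≤ 1 - 1 / (1 + b * x) := by
    rw [le_sub_iff_add_le, ← le_sub_iff_add_le', div_le_iff₀ (by linarith)]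
    rcases le_total 1 (b * x) with h | h
    · rw [min_eq_left h]; linarith
    · rw [min_eq_right h]; nlinarith
  linarith

theorem one_sub_rpow_le_two_mul_min {b x : ℝ} (hb : 0 < b) (hx : 0 ≤ x) (hx1 : x ≤ 1 / 2) :
    1 - (1 - x) ^ b ≤ 2 * min 1 (b * x) := by
  have h0 : 0 ≤ (1 - x) ^ b := Real.rpow_nonneg (by linarith) b
  have h1 : Real.exp (-(2 * x)) ≤ 1 - x := by
    have h2 : Real.exp (-(2 * x)) ≤ 1 / (1 + 2 * x) := by
      rw [Real.exp_neg, ← one_div]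
      exact one_div_le_one_div_of_le (by linarith) (by linarith [Real.add_one_le_exp (2 * x)])
    refine h2.trans ?_
    rw [div_le_iff₀ (by linarith)]
    nlinarith
  have h3 : Real.exp (-(2 * (b * x))) ≤ (1 - x) ^ b := by
    calc Real.exp (-(2 * (b * x))) = Real.exp (-(2 * x)) ^ b := by
          rw [← Real.exp_mul]; congr 1; ring
      _ ≤ (1 - x) ^ b := Real.rpow_le_rpow (Real.exp_pos _).le h1 hb.le
  rcases le_total 1 (b * x) with h | h
  · rw [min_eq_left h]; linarith
  · rw [min_eq_right h]; linarith [Real.one_sub_le_exp_neg (2 * (b * x))]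

/-- As `a → ∞` and `c → 0`, `f_{a,b,c}(t)` has the same limit as `min(1, b t^a)^c`. -/
theorem tendsto_kumaraswamy_of_tendsto_min {a b c : ℕ → ℝ} (hb : ∀ n, 0 < b n)
    (hc : ∀ n, 0 < c n) (ha' : Tendsto a atTop atTop) (hc' : Tendsto c atTop (𝓝 0)) {t l : ℝ}
    (ht : t ∈ Ioo (0 : ℝ) 1)
    (h : Tendsto (fun n => (min 1 (b n * t ^ a n)) ^ c n) atTop (𝓝 l)) :
    Tendsto (fun n => kumaraswamy (a n) (b n) (c n) t) atTop (𝓝 l) := by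
  have hsmall : ∀ᶠ n in atTop, t ^ a n ≤ 1 / 2 := by
    have : Tendsto (fun n => t ^ a n) atTop (𝓝 0) :=
      (tendsto_rpow_atTop_of_base_lt_one t (by linarith [ht.1]) ht.2).comp ha'
    exact this.eventually (ge_mem_nhds (by norm_num))
  have hconst : ∀ K : ℝ, 0 < K →
      Tendsto (fun n => K ^ c n * (min 1 (b n * t ^ a n)) ^ c n) atTop (𝓝 l) := by
    intro K hK
    have h1 : Tendsto (fun n => K ^ c n) atTop (𝓝 1) := by
      have := (Real.continuousAt_const_rpow (a := K) (b := 0) hK.ne').tendsto.comp hc'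
      simpa [Function.comp_def] using this
    simpa using h1.mul h
  refine tendsto_of_tendsto_of_tendsto_of_le_of_le' (hconst (1 / 2) (by norm_num))
    (hconst 2 (by norm_num)) ?_ ?_
  · filter_upwards [hsmall] with n hn
    have hx : 0 ≤ t ^ a n := Real.rpow_nonneg ht.1.le _
    have hmin : 0 ≤ min 1 (b n * t ^ a n) := le_min zero_le_one (mul_nonneg (hb n).le hx)
    rw [← Real.mul_rpow (by norm_num) hmin]
    exact Real.rpow_le_rpow (by positivity) (half_min_le_one_sub_rpow (hb n) hx (by linarith))
      (hc n).le
  · filter_upwards [hsmall] with n hn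
    have hx : 0 ≤ t ^ a n := Real.rpow_nonneg ht.1.le _
    have hmin : 0 ≤ min 1 (b n * t ^ a n) := le_min zero_le_one (mul_nonneg (hb n).le hx)
    rw [← Real.mul_rpow (by norm_num) hmin]
    refine Real.rpow_le_rpow ?_ (one_sub_rpow_le_two_mul_min (hb n) hx hn) (hc n).le
    exact le_trans (by positivity) (half_min_le_one_sub_rpow (hb n) hx (by linarith))

theorem monotoneClass.mem_Icc {g : ℝ → ℝ} (hg : g ∈ monotoneClass) {t : ℝ}
    (ht : t ∈ Icc (0 : ℝ) 1) : g t ∈ Icc (0 : ℝ) 1 := by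
  obtain ⟨-, hm, h0, h1⟩ := hg
  exact ⟨h0 ▸ hm (by simp) ht ht.1, h1 ▸ hm ht (by simp) ht.2⟩

/-- If `F` is an almost everywhere limit of transformations at squared distance less than `ε`
from `g`, then some transformation is at squared distance at most `ε` from `g`. -/
theorem exists_kumaraswamyError_le_of_tendsto {g F : ℝ → ℝ} (hg : g ∈ monotoneClass)
    {a b c : ℕ → ℝ} (ha : ∀ n, 0 < a n) (hb : ∀ n, 0 < b n) (hc : ∀ n, 0 < c n)
    (ha' : Tendsto a atTop atTop) (hc' : Tendsto c atTop (𝓝 0)) (s : ℝ)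
    (hF : ∀ t ∈ Ioo (0 : ℝ) 1, t ≠ s →
      Tendsto (fun n => (min 1 (b n * t ^ a n)) ^ c n) atTop (𝓝 (F t)))
    {ε : ℝ} (hlt : ∫ t in (0 : ℝ)..1, (F t - g t) ^ 2 < ε) :
    ∃ a b c : ℝ, 0 < a ∧ 0 < b ∧ 0 < c ∧ kumaraswamyError g a b c ≤ ε := by
  have hlim : Tendsto (fun n => kumaraswamyError g (a n) (b n) (c n)) atTop
      (𝓝 (∫ t in (0 : ℝ)..1, (F t - g t) ^ 2)) := by
    refine intervalIntegral.tendsto_integral_filter_of_dominated_convergence (fun _ => 1)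
      (Eventually.of_forall fun n => ?_) (Eventually.of_forall fun n => ?_) (by simp) ?_
    · have h1 : Measurable (kumaraswamy (a n) (b n) (c n)) := by
        unfold kumaraswamy; fun_prop
      have h2 : AEStronglyMeasurable g (volume.restrict (uIoc (0 : ℝ) 1)) := by
        rw [uIoc_of_le zero_le_one]
        exact (hg.1.mono Ioc_subset_Icc_self).aestronglyMeasurable measurableSet_Ioc
      exact (h1.aestronglyMeasurable.sub h2).pow 2
    · refine Eventually.of_forall fun t ht => ?_
      rw [uIoc_of_le zero_le_one] at ht
      have h1 := kumaraswamy_mem_Icc (ha n) (hb n) (hc n) (Ioc_subset_Icc_self ht)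
      have h2 := monotoneClass.mem_Icc hg (Ioc_subset_Icc_self ht)
      rw [Real.norm_eq_abs, abs_of_nonneg (sq_nonneg _), sq_le_one_iff_abs_le_one, abs_le]
      exact ⟨by linarith [h1.1, h2.2], by linarith [h1.2, h2.1]⟩
    · have h1 : ∀ᵐ t : ℝ, t ≠ s := by simp [ae_iff]
      have h2 : ∀ᵐ t : ℝ, t ≠ 1 := by simp [ae_iff]
      filter_upwards [h1, h2] with t hts ht1 ht
      rw [uIoc_of_le zero_le_one] at ht
      have ht' : t ∈ Ioo (0 : ℝ) 1 := ⟨ht.1, lt_of_le_of_ne ht.2 ht1⟩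
      exact ((tendsto_kumaraswamy_of_tendsto_min hb hc ha' hc' ht' (hF t ht' hts)).sub_const
        (g t)).pow 2
  obtain ⟨n, hn⟩ := (hlim.eventually (gt_mem_nhds hlt)).exists
  exact ⟨a n, b n, c n, ha n, hb n, hc n, hn.le⟩

theorem exists_kumaraswamyError_le_of_step {g : ℝ → ℝ} (hg : g ∈ monotoneClass) {s ε : ℝ}
    (hs : 0 < s) (hlt : (∫ t in (0 : ℝ)..1, ((if t ≤ s then 0 else 1) - g t) ^ 2) < ε) :
    ∃ a b c : ℝ, 0 < a ∧ 0 < b ∧ 0 < c ∧ kumaraswamyError g a b c ≤ ε := by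
  have hpos : ∀ n : ℕ, (0 : ℝ) < n + 1 := fun n => by positivity
  have hlin : Tendsto (fun n : ℕ => (n : ℝ) + 1) atTop atTop :=
    tendsto_atTop_add_const_right _ _ tendsto_natCast_atTop_atTop
  refine exists_kumaraswamyError_le_of_tendsto hg
    -- Here `b t^a = (t/s)^a` and `a c = n + 1 → ∞`, so the power of `t/s` tends to 0 left of `s`
    -- and is cut off at 1 right of it.
    (a := fun n => ((n : ℝ) + 1) * (n + 1)) (b := fun n => s⁻¹ ^ (((n : ℝ) + 1) * (n + 1)))
    (c := fun n => ((n : ℝ) + 1)⁻¹) (fun n => mul_pos (hpos n) (hpos n))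
    (fun n => Real.rpow_pos_of_pos (inv_pos.2 hs) _) (fun n => inv_pos.2 (hpos n))
    (hlin.atTop_mul_atTop₀ hlin) (tendsto_inv_atTop_zero.comp hlin) s (fun t ht hts => ?_) hlt
  have e : ∀ n : ℕ, (min 1 (s⁻¹ ^ (((n : ℝ) + 1) * (n + 1)) * t ^ (((n : ℝ) + 1) * (n + 1))))
      ^ ((n : ℝ) + 1)⁻¹ = min 1 ((s⁻¹ * t) ^ ((n : ℝ) + 1)) := by
    intro n
    have hz : 0 ≤ s⁻¹ * t := mul_nonneg (inv_pos.2 hs).le ht.1.le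
    rw [← Real.mul_rpow (inv_pos.2 hs).le ht.1.le, Real.rpow_mul hz,
      (Real.monotoneOn_rpow_Ici_of_exponent_nonneg (inv_pos.2 (hpos n)).le).map_min
        (by simp) (Real.rpow_nonneg (Real.rpow_nonneg hz _) _),
      Real.one_rpow, Real.rpow_rpow_inv (Real.rpow_nonneg hz _) (hpos n).ne']
  simp_rw [e]
  rcases lt_or_gt_of_ne hts with h | h
  · rw [if_pos h.le]
    have hz : s⁻¹ * t < 1 := by rw [inv_mul_lt_iff₀ hs]; linarith
    have h1 := (tendsto_rpow_atTop_of_base_lt_one (s⁻¹ * t)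
      (by linarith [mul_pos (inv_pos.2 hs) ht.1]) hz).comp hlin
    simpa [Function.comp_def] using (tendsto_const_nhds (x := (1 : ℝ))).min h1
  · rw [if_neg (not_le.2 h)]
    have hz : 1 ≤ s⁻¹ * t := by rw [le_inv_mul_iff₀ hs]; linarith
    refine tendsto_const_nhds.congr fun n => ?_
    rw [min_eq_left (Real.one_le_rpow hz (hpos n).le)]

theorem exists_kumaraswamyError_le_of_power {g : ℝ → ℝ} (hg : g ∈ monotoneClass) {A k ε : ℝ}
    (hA : 0 < A) (hk : 0 ≤ k) (hlt : (∫ t in (0 : ℝ)..1, (A * t ^ k - g t) ^ 2) < ε) :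
    ∃ a b c : ℝ, 0 < a ∧ 0 < b ∧ 0 < c ∧ kumaraswamyError g a b c ≤ ε := by
  have hpos : ∀ n : ℕ, (0 : ℝ) < n + 1 := fun n => by positivity
  have hlin : Tendsto (fun n : ℕ => (n : ℝ) + 1) atTop atTop :=
    tendsto_atTop_add_const_right _ _ tendsto_natCast_atTop_atTop
  have hinv : Tendsto (fun n : ℕ => ((n : ℝ) + 1)⁻¹) atTop (𝓝 0) :=
    tendsto_inv_atTop_zero.comp hlin
  have hkn : Tendsto (fun n : ℕ => k + ((n : ℝ) + 1)⁻¹) atTop (𝓝 k) := by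
    simpa using hinv.const_add k
  have hcpos : ∀ n : ℕ, 0 < (k + ((n : ℝ) + 1)⁻¹) * ((n : ℝ) + 1)⁻¹ := fun n => by
    have := hpos n
    positivity
  -- Truncating at 1 cannot increase the error because `g ≤ 1`, so the untruncated power may be used
  -- in all later estimates.
  have hle : (∫ t in (0 : ℝ)..1, (min 1 (A * t ^ k) - g t) ^ 2)
      ≤ ∫ t in (0 : ℝ)..1, (A * t ^ k - g t) ^ 2 := by
    have hgc : ContinuousOn g (uIcc 0 1) := by rw [uIcc_of_le zero_le_one]; exact hg.1
    have hpc : Continuous fun t : ℝ => A * t ^ k := (Real.continuous_rpow_const hk).const_mul A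
    refine intervalIntegral.integral_mono_on zero_le_one
      (((continuous_const.min hpc).continuousOn.sub hgc).pow 2).intervalIntegrable
      ((hpc.continuousOn.sub hgc).pow 2).intervalIntegrable fun t ht => ?_
    have h1 := monotoneClass.mem_Icc hg ht
    rcases le_total 1 (A * t ^ k) with h | h
    · rw [min_eq_left h]; nlinarith [h1.2]
    · rw [min_eq_right h]
  -- The choice gives `b^c = A` and `a c = k + 1/(n+1) → k`; the extra `1/(n+1)` keeps `c` positive
  -- when `k = 0`. No exceptional point is needed, and 1 is a dummy value.
  refine exists_kumaraswamyError_le_of_tendsto hg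
    (a := fun n => (n : ℝ) + 1) (b := fun n => A ^ ((k + ((n : ℝ) + 1)⁻¹) * ((n : ℝ) + 1)⁻¹)⁻¹)
    (c := fun n => (k + ((n : ℝ) + 1)⁻¹) * ((n : ℝ) + 1)⁻¹) hpos
    (fun n => Real.rpow_pos_of_pos hA _) hcpos hlin (by simpa using hkn.mul hinv) 1
    (fun t ht _ => ?_) (hle.trans_lt hlt)
  have e : ∀ n : ℕ, (min 1 (A ^ ((k + ((n : ℝ) + 1)⁻¹) * ((n : ℝ) + 1)⁻¹)⁻¹ * t ^ ((n : ℝ) + 1)))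
      ^ ((k + ((n : ℝ) + 1)⁻¹) * ((n : ℝ) + 1)⁻¹) = min 1 (A * t ^ (k + ((n : ℝ) + 1)⁻¹)) := by
    intro n
    have h1 : 0 ≤ A ^ ((k + ((n : ℝ) + 1)⁻¹) * ((n : ℝ) + 1)⁻¹)⁻¹ := Real.rpow_nonneg hA.le _
    have h2 : 0 ≤ t ^ ((n : ℝ) + 1) := Real.rpow_nonneg ht.1.le _
    rw [(Real.monotoneOn_rpow_Ici_of_exponent_nonneg (hcpos n).le).map_min
        (by simp) (mul_nonneg h1 h2), Real.one_rpow, Real.mul_rpow h1 h2,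
      Real.rpow_inv_rpow hA.le (hcpos n).ne', ← Real.rpow_mul ht.1.le]
    congr 3
    field_simp [(hpos n).ne']
  simp_rw [e]
  have h1 := (Real.continuousAt_const_rpow (a := t) (b := k) ht.1.ne').tendsto.comp hkn
  exact tendsto_const_nhds.min (h1.const_mul A)

/-! ### Moment inequalities for monotone functions. -/

/-- A one-sided second mean value inequality: a nondecreasing weight `g` integrates the derivative
of a nonnegative function vanishing at `a` to at most its boundary term at `b`. -/
theorem integral_mul_le_of_primitive_nonneg {a b : ℝ} (hab : a ≤ b) {φ g : ℝ → ℝ}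
    (hφ : ContinuousOn φ (Icc a b)) (hg : ContinuousOn g (Icc a b)) (hm : MonotoneOn g (Icc a b))
    (hK : ∀ t ∈ Icc a b, 0 ≤ ∫ x in a..t, φ x) :
    ∫ x in a..b, φ x * g x ≤ (∫ x in a..b, φ x) * g b := by
  obtain ⟨C, hC⟩ := isCompact_Icc.exists_bound_of_continuousOn hφ
  have hC0 : 0 ≤ C := (norm_nonneg _).trans (hC a (left_mem_Icc.2 hab))
  have hii : ∀ {ψ : ℝ → ℝ}, ContinuousOn ψ (Icc a b) → ∀ x ∈ Icc a b, ∀ z ∈ Icc a b,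
      IntervalIntegrable ψ volume x z := fun hψ x hx z hz =>
    (hψ.mono (ordConnected_Icc.uIcc_subset hx hz)).intervalIntegrable
  have hφg : ContinuousOn (fun x => φ x * g x) (Icc a b) := hφ.mul hg
  have hprim : ∀ {ψ : ℝ → ℝ}, ContinuousOn ψ (Icc a b) →
      ContinuousOn (fun t => ∫ x in a..t, ψ x) (Icc a b) := fun hψ => by
    have := intervalIntegral.continuousOn_primitive_interval (μ := volume)
      (by rw [uIcc_of_le hab]; exact hψ.integrableOn_Icc)
    rwa [uIcc_of_le hab] at this
  -- With `K` the primitive of `φ`, the claim is `∫ K dg ≥ 0` after integration by parts. As `g`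
  -- need not be differentiable, `∫ φ g - K g` is shown to be nonincreasing through its right
  -- slopes: on `[x, z]` these are at most `C (g z - g x)`, which tends to 0 by continuity.
  have key := image_le_of_liminf_slope_right_le_deriv_boundary
    (f := fun t => (∫ x in a..t, φ x * g x) - (∫ x in a..t, φ x) * g t)
    (B := fun _ => 0) (B' := fun _ => 0) (a := a) (b := b)
    ((hprim hφg).sub ((hprim hφ).mul hg)) (by simp) continuousOn_const
    (fun x _ => hasDerivWithinAt_const _ _ _) ?_ (right_mem_Icc.2 hab)
  · simpa using key
  intro x hx r hr
  have hxI : x ∈ Icc a b := Ico_subset_Icc_self hx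
  have haI : a ∈ Icc a b := left_mem_Icc.2 hab
  have hmem : ∀ᶠ z in 𝓝[>] x, z ∈ Ioo x b := Ioo_mem_nhdsGT hx.2
  have hlim : Tendsto (fun z => C * (g z - g x)) (𝓝[>] x) (𝓝 0) := by
    have h1 : Tendsto g (𝓝[>] x) (𝓝 (g x)) := by
      refine (hg x hxI).mono_left (nhdsWithin_le_of_mem ?_)
      filter_upwards [hmem] with z hz using ⟨hxI.1.trans hz.1.le, hz.2.le⟩
    simpa using (h1.sub_const (g x)).const_mul C
  refine Eventually.frequently ?_
  filter_upwards [hmem, hlim.eventually (gt_mem_nhds hr)] with z hz hzr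
  have hzI : z ∈ Icc a b := ⟨hxI.1.trans hz.1.le, hz.2.le⟩
  have e1 : (∫ y in a..z, φ y * g y) = (∫ y in a..x, φ y * g y) + ∫ y in x..z, φ y * g y :=
    (intervalIntegral.integral_add_adjacent_intervals (hii hφg a haI x hxI)
      (hii hφg x hxI z hzI)).symm
  have e2 : (∫ y in a..z, φ y) = (∫ y in a..x, φ y) + ∫ y in x..z, φ y :=
    (intervalIntegral.integral_add_adjacent_intervals (hii hφ a haI x hxI)
      (hii hφ x hxI z hzI)).symm
  have hsub : Icc x z ⊆ Icc a b := Icc_subset_Icc hxI.1 hzI.2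
  have e3 : (∫ y in x..z, φ y * g y) - (∫ y in x..z, φ y) * g z
      ≤ (z - x) * (C * (g z - g x)) := by
    rw [← intervalIntegral.integral_mul_const, ← intervalIntegral.integral_sub
      (hii hφg x hxI z hzI) ((hii hφ x hxI z hzI).mul_const _)]
    have : ∫ _ in x..z, C * (g z - g x) = (z - x) * (C * (g z - g x)) := by
      rw [intervalIntegral.integral_const, smul_eq_mul]
    rw [← this]
    refine intervalIntegral.integral_mono_on hz.1.le ((hii hφg x hxI z hzI).sub
      ((hii hφ x hxI z hzI).mul_const _)) (by simp) fun y hy => ?_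
    have h1 := hC y (hsub hy)
    have h2 : g y ≤ g z := hm (hsub hy) hzI hy.2
    have h3 : g x ≤ g y := hm hxI (hsub hy) hy.1
    have h4 := neg_le_of_abs_le h1
    nlinarith [mul_nonneg (by linarith : 0 ≤ φ y + C) (sub_nonneg.2 h2),
      mul_nonneg hC0 (sub_nonneg.2 h3)]
  have h5 : 0 ≤ (∫ y in a..x, φ y) * (g z - g x) :=
    mul_nonneg (hK x hxI) (sub_nonneg.2 (hm hxI hzI hz.1.le))
  refine lt_of_le_of_lt ?_ hzr
  rw [slope_def_field, div_le_iff₀ (sub_pos.2 hz.1), e1, e2]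
  nlinarith

/-- The variance of a nondecreasing function with values in `[lo, hi]` is controlled by its
covariance with the identity. -/
theorem variance_le_covariance_id {a b lo hi : ℝ} (hab : a ≤ b) {g : ℝ → ℝ}
    (hg : ContinuousOn g (Icc a b)) (hm : MonotoneOn g (Icc a b))
    (hlo : ∀ t ∈ Icc a b, lo ≤ g t) (hhi : ∀ t ∈ Icc a b, g t ≤ hi) :
    (b - a) * (∫ t in a..b, g t ^ 2) - (∫ t in a..b, g t) ^ 2
      ≤ (hi - lo) * (2 * (∫ t in a..b, t * g t) - (a + b) * ∫ t in a..b, g t) := by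
  set I := ∫ t in a..b, g t with hI
  have haI : a ∈ Icc a b := left_mem_Icc.2 hab
  have hbI : b ∈ Icc a b := right_mem_Icc.2 hab
  have hii : ∀ {ψ : ℝ → ℝ}, ContinuousOn ψ (Icc a b) → ∀ x ∈ Icc a b, ∀ z ∈ Icc a b,
      IntervalIntegrable ψ volume x z := fun hψ x hx z hz =>
    (hψ.mono (ordConnected_Icc.uIcc_subset hx hz)).intervalIntegrable
  have hprim : ∀ t ∈ Icc a b, ∫ x in a..t, ((hi - lo) * (a + b - 2 * x) - I + (b - a) * g x)
      = (hi - lo) * ((t - a) * (b - t)) - (t - a) * I + (b - a) * ∫ x in a..t, g x := by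
    intro t ht
    have h1 : IntervalIntegrable (fun x : ℝ => (hi - lo) * (a + b - 2 * x) - I) volume a t :=
      (by fun_prop : Continuous fun x : ℝ => (hi - lo) * (a + b - 2 * x) - I).intervalIntegrable _ _
    rw [intervalIntegral.integral_add h1 ((hii hg a haI t ht).const_mul _),
      intervalIntegral.integral_const_mul,
      intervalIntegral.integral_sub ((by fun_prop : Continuous fun x : ℝ =>
        (hi - lo) * (a + b - 2 * x)).intervalIntegrable _ _) (by simp),
      intervalIntegral.integral_const_mul, intervalIntegral.integral_sub (by simp)
        ((by fun_prop : Continuous fun x : ℝ => 2 * x).intervalIntegrable _ _),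
      intervalIntegral.integral_const_mul, integral_id]
    simp only [intervalIntegral.integral_const, smul_eq_mul]
    ring
  -- The primitive of this `φ` vanishes at `b`, so the inequality reads `∫ φ g ≤ 0`, which is the
  -- claim. It is nonnegative at `t` because `g ≥ lo` on `[a, t]` and `g ≤ hi` on `[t, b]`.
  have key := integral_mul_le_of_primitive_nonneg hab
    (φ := fun x => (hi - lo) * (a + b - 2 * x) - I + (b - a) * g x) (by fun_prop) hg hm ?_
  · rw [hprim b hbI, ← hI] at key
    have e : (∫ x in a..b, ((hi - lo) * (a + b - 2 * x) - I + (b - a) * g x) * g x)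
        = ((hi - lo) * (a + b) - I) * I - 2 * (hi - lo) * (∫ t in a..b, t * g t)
          + (b - a) * ∫ t in a..b, g t ^ 2 := by
      rw [hI, ← intervalIntegral.integral_const_mul, ← intervalIntegral.integral_const_mul,
        ← intervalIntegral.integral_const_mul,
        ← intervalIntegral.integral_sub (hii (by fun_prop) a haI b hbI)
          (hii (by fun_prop) a haI b hbI),
        ← intervalIntegral.integral_add (hii (by fun_prop) a haI b hbI)
          (hii (by fun_prop) a haI b hbI)]
      congr 1; ext x; ring
    rw [e] at key
    nlinarith
  intro t ht
  rw [hprim t ht]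
  have h1 : I = (∫ x in a..t, g x) + ∫ x in t..b, g x :=
    (intervalIntegral.integral_add_adjacent_intervals (hii hg a haI t ht)
      (hii hg t ht b hbI)).symm
  have h2 : (t - a) * lo ≤ ∫ x in a..t, g x := by
    have := intervalIntegral.integral_mono_on (f := fun _ => lo) ht.1 (by simp)
      (hii hg a haI t ht) (fun x hx => hlo x ⟨hx.1, hx.2.trans ht.2⟩)
    simpa using this
  have h3 : ∫ x in t..b, g x ≤ (b - t) * hi := by
    have := intervalIntegral.integral_mono_on (g := fun _ => hi) ht.2 (hii hg t ht b hbI)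
      (by simp) (fun x hx => hhi x ⟨ht.1.trans hx.1, hx.2⟩)
    simpa using this
  rw [h1]
  nlinarith [mul_le_mul_of_nonneg_left h2 (sub_nonneg.2 ht.2),
    mul_le_mul_of_nonneg_left h3 (sub_nonneg.2 ht.1)]

/-- A lower bound for the `√t`-moment of a nondecreasing function through its first two moments. -/
theorem le_integral_sqrt_mul {g : ℝ → ℝ} (hg : ContinuousOn g (Icc 0 1))
    (hm : MonotoneOn g (Icc 0 1)) (h1 : g 1 = 1) {r : ℝ} (hr : 0 < r) :
    2 / 3 * (1 - (r * (1 - ∫ t in (0 : ℝ)..1, g t) / 2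
        + (1 - 2 * ∫ t in (0 : ℝ)..1, t * g t) / (2 * r)))
      ≤ ∫ t in (0 : ℝ)..1, √t * g t := by
  have hii : ∀ {ψ : ℝ → ℝ}, ContinuousOn ψ (Icc 0 1) →
      IntervalIntegrable ψ volume 0 1 := fun hψ =>
    (hψ.mono (by rw [uIcc_of_le zero_le_one])).intervalIntegrable
  have hprim : ∀ t ∈ Icc (0 : ℝ) 1, ∫ x in (0 : ℝ)..t, (r / 2 + x / r - 3 / 2 * √x)
      = r / 2 * t + t ^ 2 / (2 * r) - t * √t := by
    intro t ht
    have hs : ∫ x in (0 : ℝ)..t, √x = 2 / 3 * (t * √t) := by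
      simp_rw [Real.sqrt_eq_rpow]
      rw [integral_rpow (Or.inl (by norm_num)), Real.zero_rpow (by norm_num),
        Real.rpow_add_one' ht.1 (by norm_num)]
      ring
    rw [intervalIntegral.integral_sub
        ((by fun_prop : Continuous fun x : ℝ => r / 2 + x / r).intervalIntegrable _ _)
        ((by fun_prop : Continuous fun x : ℝ => 3 / 2 * √x).intervalIntegrable _ _),
      intervalIntegral.integral_add (by simp)
        ((by fun_prop : Continuous fun x : ℝ => x / r).intervalIntegrable _ _),
      intervalIntegral.integral_const_mul, hs, intervalIntegral.integral_div (f := fun x => x),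
      integral_id]
    simp only [intervalIntegral.integral_const, smul_eq_mul]
    field_simp
    ring
  -- This `φ` is the derivative of `r t/2 + t²/(2r) - t^(3/2) = t (r - √t)²/(2r)`, the gap in AM-GM
  -- for `t · √t`.
  have key := integral_mul_le_of_primitive_nonneg zero_le_one
    (φ := fun x => r / 2 + x / r - 3 / 2 * √x) (by fun_prop) hg hm ?_
  · rw [hprim 1 (by simp), h1] at key
    have e : (∫ x in (0 : ℝ)..1, (r / 2 + x / r - 3 / 2 * √x) * g x)
        = r / 2 * (∫ t in (0 : ℝ)..1, g t) + 1 / r * (∫ t in (0 : ℝ)..1, t * g t)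
          - 3 / 2 * ∫ t in (0 : ℝ)..1, √t * g t := by
      rw [← intervalIntegral.integral_const_mul, ← intervalIntegral.integral_const_mul,
        ← intervalIntegral.integral_const_mul,
        ← intervalIntegral.integral_add (hii (by fun_prop)) (hii (by fun_prop)),
        ← intervalIntegral.integral_sub (hii (by fun_prop)) (hii (by fun_prop))]
      congr 1; ext x; ring
    rw [e] at key
    simp only [Real.sqrt_one] at key
    have e2 : (1 - 2 * ∫ t in (0 : ℝ)..1, t * g t) / (2 * r)
        = 1 / (2 * r) - 1 / r * ∫ t in (0 : ℝ)..1, t * g t := by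
      field_simp
    rw [e2]
    have e3 : (1 : ℝ) ^ 2 / (2 * r) = 1 / (2 * r) := by ring
    rw [e3] at key
    linarith
  intro t ht
  rw [hprim t ht]
  have h2 : r / 2 * t + t ^ 2 / (2 * r) - t * √t = t * (r - √t) ^ 2 / (2 * r) := by
    have := Real.sq_sqrt ht.1
    field_simp
    linear_combination (-t) * this
  rw [h2]
  have := ht.1
  positivity

/-! ### Numerical choice of the amplitude. -/

/-- The left side bounds 16 times the excess over 1/16 of the error of `A √t`; `r` is the AM-GM
parameter of `le_integral_sqrt_mul`. -/
theorem exists_sqrt_amplitude {u v h X : ℝ} (hu : 0 ≤ u) (hu' : u ≤ 6 / 25) (hv : v ≤ 1)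
    (hh : 0 ≤ h) (hhu : h ≤ 2 * u) (hstep : 1 / 4 ≤ v - u - h) (hX : X ≤ max v (1 - u) * h) :
    ∃ A r : ℝ, 0 < A ∧ 0 < r ∧
      15 - 12 * v - 4 * u - 4 * h + 8 * A ^ 2
        - 64 / 3 * A * (1 - (r * (u + v) / 4 + (u ^ 2 + v ^ 2 + X) / (4 * r))) < 0 := by
  -- On a rectangle the convex squares lie below their chords and the maximum lies below `κ`. With
  -- `A` and `r` fixed per rectangle the inequality becomes linear in `u`, `v`, `h`.
  have cell : ∀ u₀ u₁ v₀ v₁ κ : ℝ, u₀ ≤ u → u ≤ u₁ → v₀ ≤ v → v ≤ v₁ → v₁ ≤ κ → 1 - u₀ ≤ κ →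
      u ^ 2 + v ^ 2 + X ≤ (u₀ + u₁) * u - u₀ * u₁ + ((v₀ + v₁) * v - v₀ * v₁) + κ * h := by
    intro u₀ u₁ v₀ v₁ κ h1 h2 h3 h4 h5 h6
    have h7 : max v (1 - u) * h ≤ κ * h :=
      mul_le_mul_of_nonneg_right (max_le (by linarith) (by linarith)) hh
    nlinarith [mul_nonneg (sub_nonneg.2 h1) (sub_nonneg.2 h2),
      mul_nonneg (sub_nonneg.2 h3) (sub_nonneg.2 h4)]
  have fin : ∀ u₀ u₁ v₀ v₁ κ A r : ℝ, 0 < A → 0 < r →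
      u₀ ≤ u → u ≤ u₁ → v₀ ≤ v → v ≤ v₁ → v₁ ≤ κ → 1 - u₀ ≤ κ →
      15 - 12 * v - 4 * u - 4 * h + 8 * A ^ 2 - 64 / 3 * A * (1 - r * (u + v) / 4)
        + 16 * A / (3 * r) * ((u₀ + u₁) * u - u₀ * u₁ + ((v₀ + v₁) * v - v₀ * v₁) + κ * h) < 0 →
      ∃ A r : ℝ, 0 < A ∧ 0 < r ∧
      15 - 12 * v - 4 * u - 4 * h + 8 * A ^ 2
        - 64 / 3 * A * (1 - (r * (u + v) / 4 + (u ^ 2 + v ^ 2 + X) / (4 * r))) < 0 := by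
    intro u₀ u₁ v₀ v₁ κ A r hA hr h1 h2 h3 h4 h5 h6 H
    refine ⟨A, r, hA, hr, lt_of_le_of_lt ?_ H⟩
    have h7 := mul_le_mul_of_nonneg_left (cell u₀ u₁ v₀ v₁ κ h1 h2 h3 h4 h5 h6)
      (by positivity : 0 ≤ 16 * A / (3 * r))
    have h8 : 64 / 3 * A * ((u ^ 2 + v ^ 2 + X) / (4 * r))
        = 16 * A / (3 * r) * (u ^ 2 + v ^ 2 + X) := by
      field_simp; ring
    nlinarith
  have hv0 : u + 1 / 4 ≤ v := by linarith
  rcases le_total u 0.06 with hu1 | hu1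
  · rcases le_total v 0.51 with hv1 | hv1
    · exact fin 0 0.06 0.25 0.51 1 1.05 0.8 (by norm_num) (by norm_num) hu hu1 (by linarith) hv1
        (by norm_num) (by norm_num) (by linarith)
    rcases le_total v 0.97 with hv2 | hv2
    · exact fin 0 0.06 0.51 0.97 1 0.9 0.95 (by norm_num) (by norm_num) hu hu1 hv1 hv2
        (by norm_num) (by norm_num) (by linarith)
    · exact fin 0 0.06 0.97 1 1 0.7 1 (by norm_num) (by norm_num) hu hu1 hv2 hv
        (by norm_num) (by norm_num) (by linarith)
  rcases le_total u 0.12 with hu2 | hu2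
  · rcases le_total v 0.55 with hv1 | hv1
    · exact fin 0.06 0.12 0.31 0.55 0.94 1 0.8 (by norm_num) (by norm_num) hu1 hu2 (by linarith) hv1
        (by norm_num) (by norm_num) (by linarith)
    rcases le_total v 0.79 with hv2 | hv2
    · exact fin 0.06 0.12 0.55 0.79 0.94 0.9 0.9 (by norm_num) (by norm_num) hu1 hu2 hv1 hv2
        (by norm_num) (by norm_num) (by linarith)
    · exact fin 0.06 0.12 0.79 1 1 0.75 1 (by norm_num) (by norm_num) hu1 hu2 hv2 hv
        (by norm_num) (by norm_num) (by linarith)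
  rcases le_total u 0.18 with hu3 | hu3
  · rcases le_total v 0.62 with hv1 | hv1
    · exact fin 0.12 0.18 0.37 0.62 0.88 0.95 0.8 (by norm_num) (by norm_num) hu2 hu3
        (by linarith) hv1 (by norm_num) (by norm_num) (by linarith)
    rcases le_total v 0.91 with hv2 | hv2
    · exact fin 0.12 0.18 0.62 0.91 0.91 0.85 0.95 (by norm_num) (by norm_num) hu2 hu3 hv1 hv2
        (by norm_num) (by norm_num) (by linarith)
    · exact fin 0.12 0.18 0.91 1 1 0.65 0.9 (by norm_num) (by norm_num) hu2 hu3 hv2 hv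
        (by norm_num) (by norm_num) (by linarith)
  · have hu4 : u ≤ 0.24 := by linarith
    rcases le_total v 0.61 with hv1 | hv1
    · exact fin 0.18 0.24 0.43 0.61 0.82 0.95 0.75 (by norm_num) (by norm_num) hu3 hu4
        (by linarith) hv1 (by norm_num) (by norm_num) (by linarith)
    rcases le_total v 0.83 with hv2 | hv2
    · exact fin 0.18 0.24 0.61 0.83 0.83 0.85 0.85 (by norm_num) (by norm_num) hu3 hu4 hv1 hv2
        (by norm_num) (by norm_num) (by linarith)
    · exact fin 0.18 0.24 0.83 1 1 0.7 0.95 (by norm_num) (by norm_num) hu3 hu4 hv2 hv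
        (by norm_num) (by norm_num) (by linarith)

/-- The analogue for `A t`, with the same chord bounds on rectangles and no AM-GM parameter. -/
theorem exists_linear_amplitude {u v h X : ℝ} (hu : 6 / 25 ≤ u) (hv : v ≤ 1)
    (hh : 0 ≤ h) (hstep : 1 / 4 ≤ v - u - h) (hX : X ≤ max v (1 - u) * h) :
    ∃ A : ℝ, 0 < A ∧
      15 - 12 * v - 4 * u - 4 * h + 16 / 3 * A ^ 2 - 8 * A * (2 - (u ^ 2 + v ^ 2 + X)) < 0 := by
  have fin : ∀ u₀ u₁ v₀ v₁ κ A : ℝ, 0 < A →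
      u₀ ≤ u → u ≤ u₁ → v₀ ≤ v → v ≤ v₁ → v₁ ≤ κ → 1 - u₀ ≤ κ →
      15 - 12 * v - 4 * u - 4 * h + 16 / 3 * A ^ 2 - 8 * A * (2 -
        ((u₀ + u₁) * u - u₀ * u₁ + ((v₀ + v₁) * v - v₀ * v₁) + κ * h)) < 0 →
      ∃ A : ℝ, 0 < A ∧
      15 - 12 * v - 4 * u - 4 * h + 16 / 3 * A ^ 2 - 8 * A * (2 - (u ^ 2 + v ^ 2 + X)) < 0 := by
    intro u₀ u₁ v₀ v₁ κ A hA h1 h2 h3 h4 h5 h6 H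
    refine ⟨A, hA, lt_of_le_of_lt ?_ H⟩
    have h7 : max v (1 - u) * h ≤ κ * h :=
      mul_le_mul_of_nonneg_right (max_le (by linarith) (by linarith)) hh
    have h8 : u ^ 2 + v ^ 2 + X ≤
        (u₀ + u₁) * u - u₀ * u₁ + ((v₀ + v₁) * v - v₀ * v₁) + κ * h := by
      nlinarith [mul_nonneg (sub_nonneg.2 h1) (sub_nonneg.2 h2),
        mul_nonneg (sub_nonneg.2 h3) (sub_nonneg.2 h4)]
    have h9 := mul_le_mul_of_nonneg_left h8 (by positivity : 0 ≤ 8 * A)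
    linarith
  have hv0 : u + 1 / 4 ≤ v := by linarith
  have hu0 : 0.24 ≤ u := by linarith
  rcases le_total u 0.34 with hu1 | hu1
  · rcases le_total v 0.78 with hv1 | hv1
    · exact fin 0.24 0.34 0.49 0.78 0.78 1 (by norm_num) hu0 hu1 (by linarith) hv1
        (by norm_num) (by norm_num) (by linarith)
    rcases le_total v 0.86 with hv2 | hv2
    · exact fin 0.24 0.34 0.78 0.86 0.86 0.8 (by norm_num) hu0 hu1 hv1 hv2
        (by norm_num) (by norm_num) (by linarith)
    rcases le_total v 0.91 with hv3 | hv3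
    · exact fin 0.24 0.34 0.86 0.91 0.91 0.65 (by norm_num) hu0 hu1 hv2 hv3
        (by norm_num) (by norm_num) (by linarith)
    rcases le_total v 0.99 with hv4 | hv4
    · exact fin 0.24 0.34 0.91 0.99 0.99 0.55 (by norm_num) hu0 hu1 hv3 hv4
        (by norm_num) (by norm_num) (by linarith)
    · exact fin 0.24 0.34 0.99 1 1 0.5 (by norm_num) hu0 hu1 hv4 hv
        (by norm_num) (by norm_num) (by linarith)
  rcases le_total u 0.44 with hu2 | hu2
  · rcases le_total v 0.88 with hv1 | hv1
    · exact fin 0.34 0.44 0.59 0.88 0.88 0.85 (by norm_num) hu1 hu2 (by linarith) hv1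
        (by norm_num) (by norm_num) (by linarith)
    · exact fin 0.34 0.44 0.88 1 1 0.6 (by norm_num) hu1 hu2 hv1 hv
        (by norm_num) (by norm_num) (by linarith)
  rcases le_total u 0.54 with hu3 | hu3
  · rcases le_total v 0.99 with hv1 | hv1
    · exact fin 0.44 0.54 0.69 0.99 0.99 0.75 (by norm_num) hu2 hu3 (by linarith) hv1
        (by norm_num) (by norm_num) (by linarith)
    · exact fin 0.44 0.54 0.99 1 1 0.5 (by norm_num) hu2 hu3 hv1 hv
        (by norm_num) (by norm_num) (by linarith)
  · exact fin 0.54 0.75 0.79 1 1 0.65 (by norm_num) hu3 (by linarith) (by linarith) hv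
      (by norm_num) (by norm_num) (by linarith)

/-! ### Error formulas and statistics of the two halves. -/

theorem integral_mul_rpow_sub_sq {g : ℝ → ℝ} (hg : ContinuousOn g (Icc 0 1)) (A : ℝ) {k : ℝ}
    (hk : 0 ≤ k) :
    ∫ t in (0 : ℝ)..1, (A * t ^ k - g t) ^ 2
      = A ^ 2 / (2 * k + 1) - 2 * A * (∫ t in (0 : ℝ)..1, t ^ k * g t)
        + ∫ t in (0 : ℝ)..1, g t ^ 2 := by
  have hii : ∀ {ψ : ℝ → ℝ}, ContinuousOn ψ (Icc 0 1) →
      IntervalIntegrable ψ volume 0 1 := fun hψ =>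
    (hψ.mono (by rw [uIcc_of_le zero_le_one])).intervalIntegrable
  have hp : ContinuousOn (fun t : ℝ => t ^ k) (Icc 0 1) :=
    (Real.continuous_rpow_const hk).continuousOn
  have h2 : ∫ t in (0 : ℝ)..1, (t ^ k) ^ 2 = 1 / (2 * k + 1) := by
    have : ∫ t in (0 : ℝ)..1, (t ^ k) ^ 2 = ∫ t in (0 : ℝ)..1, t ^ (2 * k) := by
      refine intervalIntegral.integral_congr fun t ht => ?_
      rw [uIcc_of_le zero_le_one] at ht
      rw [← Real.rpow_natCast, ← Real.rpow_mul ht.1]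
      congr 1
      push_cast
      ring
    rw [this, integral_rpow (Or.inl (by linarith)), Real.one_rpow,
      Real.zero_rpow (by linarith), sub_zero]
  have e : A ^ 2 / (2 * k + 1) = A ^ 2 * ∫ t in (0 : ℝ)..1, (t ^ k) ^ 2 := by
    rw [h2]; ring
  have hp2 : ContinuousOn (fun t : ℝ => A ^ 2 * (t ^ k) ^ 2) (Icc 0 1) := by fun_prop
  have hpg : ContinuousOn (fun t : ℝ => 2 * A * (t ^ k * g t)) (Icc 0 1) := by fun_prop
  have hg2 : ContinuousOn (fun t => g t ^ 2) (Icc 0 1) := by fun_prop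
  rw [e, ← intervalIntegral.integral_const_mul, ← intervalIntegral.integral_const_mul,
    ← intervalIntegral.integral_sub (hii hp2) (hii hpg),
    ← intervalIntegral.integral_add ((hii hp2).sub (hii hpg)) (hii hg2)]
  congr 1; ext t; ring

theorem integral_step_sub_sq {g : ℝ → ℝ} (hg : ContinuousOn g (Icc 0 1)) {s : ℝ}
    (hs : s ∈ Icc (0 : ℝ) 1) :
    ∫ t in (0 : ℝ)..1, ((if t ≤ s then 0 else 1) - g t) ^ 2
      = (∫ t in (0 : ℝ)..s, g t ^ 2) + ∫ t in s..1, (1 - g t) ^ 2 := by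
  have hL : ContinuousOn g (uIcc 0 s) :=
    hg.mono (by rw [uIcc_of_le hs.1]; exact Icc_subset_Icc_right hs.2)
  have hR : ContinuousOn g (uIcc s 1) :=
    hg.mono (by rw [uIcc_of_le hs.2]; exact Icc_subset_Icc_left hs.1)
  have eL : EqOn (fun t => g t ^ 2) (fun t => ((if t ≤ s then 0 else 1) - g t) ^ 2)
      (uIoc 0 s) := fun t ht => by
    rw [uIoc_of_le hs.1] at ht
    simp [ht.2]
  have eR : EqOn (fun t => (1 - g t) ^ 2) (fun t => ((if t ≤ s then 0 else 1) - g t) ^ 2)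
      (uIoc s 1) := fun t ht => by
    rw [uIoc_of_le hs.2] at ht
    simp [not_le.2 ht.1]
  rw [← intervalIntegral.integral_add_adjacent_intervals
      ((hL.pow 2).intervalIntegrable.congr eL)
      (((continuousOn_const.sub hR).pow 2).intervalIntegrable.congr eR),
    intervalIntegral.integral_congr_ae (Eventually.of_forall fun t ht => (eL ht).symm),
    intervalIntegral.integral_congr_ae (Eventually.of_forall fun t ht => (eR ht).symm)]

/-- Summary of a class member by the data of its upper and lower halves: in terms of a random
variable with distribution function `g`, `u` and `v` are the means of its lower and upper halves
and `h` is the sum of half their mean differences. -/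
theorem exists_half_statistics {g : ℝ → ℝ} (hg : g ∈ monotoneClass) :
    ∃ s u v h X : ℝ, 0 < s ∧ 0 ≤ u ∧ v ≤ 1 ∧ 0 ≤ h ∧ X ≤ max v (1 - u) * h ∧
      (∫ t in (0 : ℝ)..1, ((if t ≤ s then 0 else 1) - g t) ^ 2) = (v - u - h) / 4 ∧
      (∫ t in (0 : ℝ)..1, g t ^ 2) = (v - u - h) / 4 + 1 - v ∧
      (∫ t in (0 : ℝ)..1, g t) = 1 - (u + v) / 2 ∧
      (2 - (u ^ 2 + v ^ 2 + X)) / 4 ≤ ∫ t in (0 : ℝ)..1, t * g t := by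
  have hg01 := fun t ht => monotoneClass.mem_Icc hg (t := t) ht
  obtain ⟨hc, hm, h0, h1⟩ := hg
  obtain ⟨s, hs, hgs⟩ : (1 / 2 : ℝ) ∈ g '' Icc 0 1 :=
    intermediate_value_Icc zero_le_one hc (by rw [h0, h1]; constructor <;> norm_num)
  have hs0 : 0 < s := lt_of_le_of_ne hs.1 (by rintro rfl; norm_num [h0] at hgs)
  have sL : Icc 0 s ⊆ Icc (0 : ℝ) 1 := Icc_subset_Icc_right hs.2
  have sR : Icc s 1 ⊆ Icc (0 : ℝ) 1 := Icc_subset_Icc_left hs.1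
  have bL : ∀ t ∈ Icc 0 s, g t ≤ 1 / 2 := fun t ht => hgs ▸ hm (sL ht) hs ht.2
  have bR : ∀ t ∈ Icc s 1, 1 / 2 ≤ g t := fun t ht => hgs ▸ hm hs (sR ht) ht.1
  have iL : ∀ {ψ : ℝ → ℝ}, ContinuousOn ψ (Icc 0 1) → IntervalIntegrable ψ volume 0 s :=
    fun hψ => (hψ.mono (by rwa [uIcc_of_le hs.1])).intervalIntegrable
  have iR : ∀ {ψ : ℝ → ℝ}, ContinuousOn ψ (Icc 0 1) → IntervalIntegrable ψ volume s 1 :=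
    fun hψ => (hψ.mono (by rwa [uIcc_of_le hs.2])).intervalIntegrable
  have split : ∀ {ψ : ℝ → ℝ}, ContinuousOn ψ (Icc 0 1) →
      ∫ t in (0 : ℝ)..1, ψ t = (∫ t in (0 : ℝ)..s, ψ t) + ∫ t in s..1, ψ t := fun hψ =>
    (intervalIntegral.integral_add_adjacent_intervals (iL hψ) (iR hψ)).symm
  have hc2 : ContinuousOn (fun t => g t ^ 2) (Icc 0 1) := hc.pow 2
  have hct : ContinuousOn (fun t => t * g t) (Icc 0 1) := continuousOn_id.mul hc
  -- In terms of `Y`, each half has variance at most the length of its interval, `s` or `1 - s`,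
  -- times half its mean difference.
  have cL := variance_le_covariance_id hs.1 (hc.mono sL) (hm.mono sL)
    (fun t ht => (hg01 t (sL ht)).1) bL
  have cR := variance_le_covariance_id hs.2 (hc.mono sR) (hm.mono sR) bR
    (fun t ht => (hg01 t (sR ht)).2)
  have qR : ∫ t in s..1, (1 - g t) ^ 2
      = (1 - s) - 2 * (∫ t in s..1, g t) + ∫ t in s..1, g t ^ 2 := by
    have e1 : ∫ _ in s..1, (1 : ℝ) = 1 - s := by simp
    rw [← e1, ← intervalIntegral.integral_const_mul,
      ← intervalIntegral.integral_sub (by simp) ((iR hc).const_mul 2),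
      ← intervalIntegral.integral_add ((by simp : IntervalIntegrable (fun _ => (1 : ℝ)) volume s
        1).sub ((iR hc).const_mul 2)) (iR hc2)]
    congr 1; ext t; ring
  have l1 : (∫ t in (0 : ℝ)..s, g t) ≤ s / 2 := by
    have := intervalIntegral.integral_mono_on hs.1 (iL hc) (g := fun _ => (1 / 2 : ℝ)) (by simp) bL
    simp only [intervalIntegral.integral_const, smul_eq_mul] at this
    linarith
  have l2 : (∫ t in (0 : ℝ)..s, g t ^ 2) ≤ 1 / 2 * ∫ t in (0 : ℝ)..s, g t := by
    rw [← intervalIntegral.integral_const_mul]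
    refine intervalIntegral.integral_mono_on hs.1 (iL hc2) ((iL hc).const_mul _) fun t ht => ?_
    nlinarith [bL t ht, (hg01 t (sL ht)).1]
  have l3 : 0 ≤ ∫ t in (0 : ℝ)..s, g t :=
    intervalIntegral.integral_nonneg hs.1 fun t ht => (hg01 t (sL ht)).1
  have r1 : (1 - s) / 2 ≤ ∫ t in s..1, g t := by
    have := intervalIntegral.integral_mono_on hs.2 (f := fun _ => (1 / 2 : ℝ)) (by simp) (iR hc) bR
    simp only [intervalIntegral.integral_const, smul_eq_mul] at this
    linarith
  have r2 : (∫ t in s..1, g t ^ 2) ≤ 3 / 2 * (∫ t in s..1, g t) - (1 - s) / 2 := by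
    have e1 : ∫ _ in s..1, (1 / 2 : ℝ) = (1 - s) / 2 := by simp; ring
    rw [← e1, ← intervalIntegral.integral_const_mul,
      ← intervalIntegral.integral_sub ((iR hc).const_mul _) (by simp)]
    refine intervalIntegral.integral_mono_on hs.2 (iR hc2) (((iR hc).const_mul _).sub (by simp))
      fun t ht => ?_
    nlinarith [bR t ht, (hg01 t (sR ht)).2]
  have r3 : (∫ t in s..1, g t) ≤ 1 - s := by
    have := intervalIntegral.integral_mono_on hs.2 (iR hc) (g := fun _ => (1 : ℝ)) (by simp)
      fun t ht => (hg01 t (sR ht)).2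
    simpa using this
  refine ⟨s, ?_⟩
  rw [integral_step_sub_sq hc hs, split hc2, split hc, split hct, qR]
  generalize (∫ t in (0 : ℝ)..s, g t) = aL at *
  generalize (∫ t in (0 : ℝ)..s, g t ^ 2) = pL at *
  generalize (∫ t in (0 : ℝ)..s, t * g t) = tL at *
  generalize (∫ t in s..1, g t) = aR at *
  generalize (∫ t in s..1, g t ^ 2) = pR at *
  generalize (∫ t in s..1, t * g t) = tR at *
  have he : 0 ≤ 2 * aL - 4 * pL := by linarith
  have hf : 0 ≤ 2 * (1 - s - aR) - 4 * (1 - s - 2 * aR + pR) := by linarith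
  -- The halves have distribution functions `2 g` on `[0, s]` and `2 g - 1` on `[s, 1]`. The two
  -- summands of `h` are the integrals of `G (1 - G)` for these `G`. `X` weights them by `s` and `1
  -- - s`, hence bounds the sum of the two variances; its own bound follows from `u ≤ s ≤ v`.
  refine ⟨s - 2 * aL, s + 2 * (1 - s - aR),
    (2 * aL - 4 * pL) + (2 * (1 - s - aR) - 4 * (1 - s - 2 * aR + pR)),
    s * (2 * aL - 4 * pL) + (1 - s) * (2 * (1 - s - aR) - 4 * (1 - s - 2 * aR + pR)),
    hs0, by linarith, by linarith, by linarith, ?_, by ring, by ring, by ring, ?_⟩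
  · have k1 : s ≤ max (s + 2 * (1 - s - aR)) (1 - (s - 2 * aL)) :=
      le_max_of_le_left (by linarith)
    have k2 : 1 - s ≤ max (s + 2 * (1 - s - aR)) (1 - (s - 2 * aL)) :=
      le_max_of_le_right (by linarith)
    refine (add_le_add (mul_le_mul_of_nonneg_right k1 he)
      (mul_le_mul_of_nonneg_right k2 hf)).trans_eq ?_
    ring
  · nlinarith

/-! ### Case distinction and conclusion. -/

theorem exists_kumaraswamyError_le {g : ℝ → ℝ} (hg : g ∈ monotoneClass) :
    ∃ a b c : ℝ, 0 < a ∧ 0 < b ∧ 0 < c ∧ kumaraswamyError g a b c ≤ 1 / 16 := by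
  obtain ⟨s, u, v, h, X, hs, hu, hv, hh, hX, hS, hQ, hm0, hm1⟩ := exists_half_statistics hg
  rcases lt_or_ge (v - u - h) (1 / 4) with hstep | hstep
  · exact exists_kumaraswamyError_le_of_step hg hs (by rw [hS]; linarith)
  rcases lt_or_ge (2 * u) h with hhu | hhu
  -- The best constant is the mean of `g`. Its error `(v + 3u - h - (u + v)²)/4` is less than `(w -
  -- w²)/4 ≤ 1/16` with `w = u + v`, because `h > 2u`.
  · refine exists_kumaraswamyError_le_of_power hg (A := 1 - (u + v) / 2) (k := 0) (by linarith)
      le_rfl ?_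
    rw [integral_mul_rpow_sub_sq hg.1 _ le_rfl, hQ]
    simp only [Real.rpow_zero, one_mul]
    rw [hm0]
    nlinarith [sq_nonneg (1 - 2 * u - 2 * v)]
  rcases le_total u (6 / 25) with hu' | hu'
  · obtain ⟨A, r, hA, hr, hW⟩ := exists_sqrt_amplitude hu hu' hv hh hhu hstep hX
    refine exists_kumaraswamyError_le_of_power hg (k := 1 / 2) hA (by norm_num) ?_
    rw [integral_mul_rpow_sub_sq hg.1 _ (by norm_num), hQ]
    simp only [← Real.sqrt_eq_rpow]
    have h1 := le_integral_sqrt_mul hg.1 hg.2.1 hg.2.2.2 hr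
    rw [hm0] at h1
    have h2 : (1 - 2 * ∫ t in (0 : ℝ)..1, t * g t) / (2 * r)
        ≤ (u ^ 2 + v ^ 2 + X) / (4 * r) := by
      rw [div_le_div_iff₀ (by positivity) (by positivity)]
      nlinarith
    have h3 : 2 / 3 * (1 - (r * (u + v) / 4 + (u ^ 2 + v ^ 2 + X) / (4 * r)))
        ≤ ∫ t in (0 : ℝ)..1, √t * g t := by linarith
    have h4 := mul_le_mul_of_nonneg_left h3 hA.le
    linarith
  · obtain ⟨A, hA, hW⟩ := exists_linear_amplitude hu' hv hh hstep hX
    refine exists_kumaraswamyError_le_of_power hg (k := 1) hA zero_le_one ?_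
    rw [integral_mul_rpow_sub_sq hg.1 _ zero_le_one, hQ]
    simp only [Real.rpow_one]
    have h4 := mul_le_mul_of_nonneg_left hm1 hA.le
    linarith

theorem mainTheorem6 :
    (⨆ g ∈ monotoneClass, ⨅ (a : ℝ) (_ : 0 < a) (b : ℝ) (_ : 0 < b) (c : ℝ) (_ : 0 < c),
        ((kumaraswamyError g a b c : ℝ) : EReal)) ≤ ((1 / 16 : ℝ) : EReal) ∧
      ∀ g ∈ monotoneClass, ∃ a b c : ℝ, 0 < a ∧ 0 < b ∧ 0 < c ∧
        kumaraswamyError g a b c ≤ 1 / 16 := by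
  refine ⟨iSup₂_le fun g hg => ?_, fun g hg => exists_kumaraswamyError_le hg⟩
  obtain ⟨a, b, c, ha, hb, hc, hle⟩ := exists_kumaraswamyError_le hg
  exact (iInf₂_le a ha).trans <| (iInf₂_le b hb).trans <| (iInf₂_le c hc).trans <|
    EReal.coe_le_coe_iff.2 hle
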